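/- Let $\alpha \ge 1$ and consider the planar differential system \[ \dot m = -\alpha n + m - \frac{m^3}{3}, \qquad \dot n = \alpha m + n - \frac{n^3}{3}. \] From every starting point in $\mathbb R^2$ there is a solution defined for all times $t \ge 0$. The system admits a unique non-constant periodic orbit $\mathscr C_\alpha$, that is, exactly one set of the form $\{(m_t,n_t) : t \in \mathbb R\}$ where $(m_t,n_t)_{t \in \mathbb R}$ is a non-constant periodic solution. This orbit is contained in the annulus \[ \{(m,n) \in \mathbb R^2 : 3 \le m^2 + n^2 \le 6\}. \] All solutions $(m_t,n_t)_{t\in\mathbb R}$ with $(m_0,n_0) \in \mathscr C_\alpha$ run through the whole of $\mathscr C_\alpha$ and are periodic with the same smallest period $T_\alpha > 0$. The orbit circles around the origin: over one period $[0,T_\alpha]$, such a solution has winding number $1$ around the origin. Every solution $(m_t,n_t)_{t \ge 0}$ other than the one that stays at the origin has $\mathscr C_\alpha$ as its limit cycle: its $\omega$-limit set (the set of cluster points of $(m_t,n_t)$ as $t \to +\infty$) is equal to $\mathscr C_\alpha$, and the distance from $(m_t,n_t)$ to $\mathscr C_\alpha$ tends to $0$ as $t \to +\infty$. Finally, \[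 \frac{4\pi}{2\alpha+1} \le T_\alpha \le \frac{4\pi}{2\alpha-1}. \] -/

import Mathlib

open Set Filter Topology

noncomputable section

namespace LimitCycle

/-- The Euclidean plane. -/
abbrev Plane : Type := EuclideanSpace ℝ (Fin 2)

/-- The vector field `(m, n) ↦ (-α n + m - m³/3, α m + n - n³/3)`. -/
def field (α : ℝ) (z : Plane) : Plane :=
  !₂[-α * z 1 + z 0 - z 0 ^ 3 / 3, α * z 0 + z 1 - z 1 ^ 3 / 3]

/-- The closed annulus `3 ≤ m² + n² ≤ 6`. -/
def annulus : Set Plane :=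
  {z | 3 ≤ z 0 ^ 2 + z 1 ^ 2 ∧ z 0 ^ 2 + z 1 ^ 2 ≤ 6}

/-- `γ : ℝ → ℝ²` is a solution of `ż = F z` for all times in `ℝ`. -/
def IsSolution (F : Plane → Plane) (γ : ℝ → Plane) : Prop :=
  IsIntegralCurve γ (fun _ ↦ F)

/-- `γ` is a forward trajectory of `ż = F z`, that is, a solution on `[0, ∞)`
(its values at negative times are irrelevant). -/
def IsForwardTrajectory (F : Plane → Plane) (γ : ℝ → Plane) : Prop :=
  IsIntegralCurveOn γ (fun _ ↦ F) (Ici 0)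

/-- `C` is the orbit of a non-constant periodic solution of `ż = F z`. -/
def IsNonconstantPeriodicOrbit (F : Plane → Plane) (C : Set Plane) : Prop :=
  ∃ γ : ℝ → Plane, IsSolution F γ ∧ (∃ T : ℝ, 0 < T ∧ Function.Periodic γ T) ∧
    (∃ s t : ℝ, γ s ≠ γ t) ∧ range γ = C

/-- `T` is the smallest positive period of `γ`. -/
def IsMinimalPeriod (γ : ℝ → Plane) (T : ℝ) : Prop :=
  IsLeast {S : ℝ | 0 < S ∧ Function.Periodic γ S} T

/-- The curve `γ` restricted to `[0, T]` avoids the origin and its winding number around the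
origin is `k`: a continuous choice `θ` of the polar angle along it increases by `2πk`. -/
def HasWindingNumber (γ : ℝ → Plane) (T : ℝ) (k : ℤ) : Prop :=
  ∃ θ : ℝ → ℝ, ContinuousOn θ (Icc 0 T) ∧
    (∀ t ∈ Icc 0 T, γ t ≠ 0 ∧ γ t = ‖γ t‖ • !₂[Real.cos (θ t), Real.sin (θ t)]) ∧
    θ T - θ 0 = 2 * Real.pi * k

/-- The ω-limit set of `γ`: the cluster points of `γ t` as `t → ∞`. -/
def omegaLimitSet (γ : ℝ → Plane) : Set Plane :=
  {p | MapClusterPt p atTop γ}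

end LimitCycle

end

noncomputable section

namespace LimitCycle

open scoped NNReal
open Real (sin cos)

/-! With u = m² + n² and polar angle φ the system reads u' = `growth u φ`, φ' = `speed α u φ`. For α
≥ 1 and u ≤ 8 the angular velocity is at least 1/3, so φ can replace time and u solves du/dφ =
growth/speed.

The key is the function P = αu + u² sin(4φ)/24 (`potential`). Its u-derivative is the angular
velocity, and along the flow dP/dφ = 2u − u²/2, with no explicit dependence on φ
(`hasDerivAt_potential`). For two solutions u, v compared at the same angle, P(u) − P(v) = κ(u − v)
with 1/3 ≤ κ ≤ 2α, while its φ-derivative is −(u − v)((u + v)/2 − 2). When u, v ≥ 5/2 the last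
factor is at least 1/2, so the difference decays exponentially (`potential_sub_sq_le`).

Existence: the return map over one turn sends [3, 6] into itself and is 1-Lipschitz, so it has a
fixed point: a 2π-periodic profile U. Solving θ' = `speed α (U θ) θ` sets the curve in motion; T is
the time of one turn, and the bounds on T follow from |θ' − α| ≤ 1/2.

Attraction: 1/u satisfies linear differential inequalities that force a nonzero trajectory into 5/2
≤ u ≤ 8. There it has a polar angle θ(t), and the contraction applies to u(t) and U(θ(t)). As θ → ∞
continuously, every point of the curve is a cluster point. Uniqueness follows, since a periodic
orbit is its own ω-limit set. -/

/-! ### Global solutions, uniqueness and differential inequalities. -/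

/-- An ordinary differential equation with bounded, uniformly Lipschitz right-hand side has a
solution on the whole line through every point. -/
theorem exists_global_solution {E : Type*} [NormedAddCommGroup E] [NormedSpace ℝ E]
    [CompleteSpace E] {f : ℝ → E → E} {K L : ℝ≥0} (hK : ∀ t, LipschitzWith K (f t))
    (hc : ∀ x, Continuous (f · x)) (hL : ∀ t x, ‖f t x‖ ≤ L) (x₀ : E) :
    ∃ γ : ℝ → E, γ 0 = x₀ ∧ ∀ t, HasDerivAt γ (f t (γ t)) t := by
  have key (n : ℕ) : ∃ γ : ℝ → E, γ 0 = x₀ ∧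
      ∀ t ∈ Ioo (-(n + 1 : ℝ)) (n + 1), HasDerivAt γ (f t (γ t)) t := by
    have h0 : (0 : ℝ) ∈ Icc (-(n + 1 : ℝ)) (n + 1) := by
      constructor <;> linarith [n.cast_nonneg (α := ℝ)]
    -- At speed at most L, the ball of radius L(n + 1) cannot be left during this interval.
    have hpl : IsPicardLindelof f (⟨0, h0⟩ : Icc (-(n + 1 : ℝ)) (n + 1)) x₀
        (L * (n + 1)) 0 L K :=
      { lipschitzOnWith := fun t _ ↦ (hK t).lipschitzOnWith
        continuousOn := fun x _ ↦ (hc x).continuousOn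
        norm_le := fun t _ x _ ↦ hL t x
        mul_max_le := by simp }
    obtain ⟨γ, hγ0, hγ⟩ := hpl.exists_eq_forall_mem_Icc_hasDerivWithinAt₀
    exact ⟨γ, hγ0, fun t ht ↦ (hγ t (Ioo_subset_Icc_self ht)).hasDerivAt (Icc_mem_nhds ht.1 ht.2)⟩
  choose γ hγ0 hγ using key
  have agree {n m : ℕ} (hnm : n ≤ m) : EqOn (γ n) (γ m) (Ioo (-(n + 1 : ℝ)) (n + 1)) := by
    have hnm' : (n : ℝ) ≤ m := by exact_mod_cast hnm
    refine ODE_solution_unique_of_mem_Ioo (s := fun _ ↦ univ) (t₀ := 0)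
      (fun t _ ↦ (hK t).lipschitzOnWith) ?_ (fun t ht ↦ ⟨hγ n t ht, trivial⟩)
      (fun t ht ↦ ⟨hγ m t ?_, trivial⟩) (by rw [hγ0, hγ0])
    · constructor <;> linarith [n.cast_nonneg (α := ℝ)]
    · constructor <;> linarith [ht.1, ht.2]
  refine ⟨fun t ↦ γ ⌈|t|⌉₊ t, by simp [hγ0], fun t ↦ ?_⟩
  have hmem {s : ℝ} {n : ℕ} (h : |s| < n + 1) : s ∈ Ioo (-(n + 1 : ℝ)) (n + 1) := abs_lt.1 h
  -- The index ⌈|s|⌉₊ may jump at t; one index larger serves for all s near t.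
  have hev : (fun s ↦ γ ⌈|s|⌉₊ s) =ᶠ[𝓝 t] γ (⌈|t|⌉₊ + 1) := by
    have : ∀ᶠ s in 𝓝 t, |s| < |t| + 1 :=
      continuous_abs.continuousAt.eventually_lt continuousAt_const (by linarith)
    filter_upwards [this] with s hs
    refine agree ?_ (hmem ((Nat.le_ceil _).trans_lt (by linarith)))
    rw [Nat.ceil_le]
    push_cast
    linarith [Nat.le_ceil |t|]
  have hd := (hγ (⌈|t|⌉₊ + 1) t
    (hmem (by push_cast; linarith [Nat.le_ceil |t|]))).congr_of_eventuallyEq hev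
  rwa [← hev.eq_of_nhds] at hd

/-- Uniqueness of solutions of an autonomous equation with continuously differentiable
right-hand side. -/
theorem eqOn_Icc_of_contDiff {E : Type*} [NormedAddCommGroup E] [NormedSpace ℝ E]
    [FiniteDimensional ℝ E] {F : E → E} (hF : ContDiff ℝ 1 F) {f g : ℝ → E} {a b t₀ : ℝ}
    (ht₀ : t₀ ∈ Ioo a b) (hf : ContinuousOn f (Icc a b))
    (hf' : ∀ t ∈ Ioo a b, HasDerivAt f (F (f t)) t) (hg : ContinuousOn g (Icc a b))
    (hg' : ∀ t ∈ Ioo a b, HasDerivAt g (F (g t)) t) (h : f t₀ = g t₀) : EqOn f g (Icc a b) := by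
  have : ProperSpace E := FiniteDimensional.proper_real E
  obtain ⟨R, hR⟩ := ((isCompact_Icc.image_of_continuousOn hf).union
    (isCompact_Icc.image_of_continuousOn hg)).isBounded.subset_closedBall 0
  obtain ⟨K, hK⟩ := hF.contDiffOn.exists_lipschitzOnWith (n := 1) (by simp)
    (convex_closedBall (0 : E) R) (isCompact_closedBall 0 R)
  exact ODE_solution_unique_of_mem_Icc (v := fun _ ↦ F) (s := fun _ ↦ Metric.closedBall 0 R)
    (fun _ _ ↦ hK) ht₀ hf hf' (fun t ht ↦ hR (.inl ⟨t, Ioo_subset_Icc_self ht, rfl⟩))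
    hg hg' (fun t ht ↦ hR (.inr ⟨t, Ioo_subset_Icc_self ht, rfl⟩)) h

theorem eq_of_contDiff {E : Type*} [NormedAddCommGroup E] [NormedSpace ℝ E]
    [FiniteDimensional ℝ E] {F : E → E} (hF : ContDiff ℝ 1 F) {f g : ℝ → E}
    (hf : ∀ t, HasDerivAt f (F (f t)) t) (hg : ∀ t, HasDerivAt g (F (g t)) t) {t₀ : ℝ}
    (h : f t₀ = g t₀) : f = g := by
  ext t
  refine eqOn_Icc_of_contDiff hF (a := min t t₀ - 1) (b := max t t₀ + 1) (t₀ := t₀) ?_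
    (fun s _ ↦ (hf s).continuousAt.continuousWithinAt) (fun s _ ↦ hf s)
    (fun s _ ↦ (hg s).continuousAt.continuousWithinAt) (fun s _ ↦ hg s) h ?_ <;>
  constructor <;>
  linarith [min_le_left t t₀, min_le_right t t₀, le_max_left t t₀, le_max_right t t₀]

/-- A function that is nonincreasing whenever it exceeds `c` stays below `c` once it is there. -/
theorem le_of_hasDerivAt_nonpos_above {f f' : ℝ → ℝ} {a c : ℝ}
    (hf : ∀ t ≥ a, HasDerivWithinAt f (f' t) (Ici a) t) (h : ∀ t ≥ a, c < f t → f' t ≤ 0)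
    (ha : f a ≤ c) {t : ℝ} (ht : a ≤ t) : f t ≤ c := by
  by_contra! hlt
  have hcont : ContinuousOn f (Ici a) := fun s hs ↦ (hf s hs).continuousWithinAt
  have hS : IsCompact (Icc a t ∩ f ⁻¹' Iic c) :=
    isCompact_Icc.of_isClosed_subset
      ((hcont.mono Icc_subset_Ici_self).preimage_isClosed_of_isClosed isClosed_Icc isClosed_Iic)
      inter_subset_left
  -- Here s is the last time before t with f ≤ c; from then on f cannot increase.
  obtain ⟨s, ⟨⟨has, hst⟩, hsc⟩, hmax⟩ := hS.exists_isGreatest ⟨a, ⟨le_rfl, ht⟩, ha⟩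
  have hgt : ∀ x ∈ Ioo s t, c < f x := fun x hx ↦ by
    by_contra! hx'
    exact absurd (hmax ⟨⟨has.trans hx.1.le, hx.2.le⟩, hx'⟩) (not_le.2 hx.1)
  have hanti : AntitoneOn f (Icc s t) := by
    refine antitoneOn_of_hasDerivWithinAt_nonpos (f' := f') (convex_Icc s t)
      (hcont.mono fun x hx ↦ has.trans hx.1) ?_ ?_
    · intro x hx
      rw [interior_Icc] at hx ⊢
      exact (hf x (has.trans hx.1.le)).mono fun y hy ↦ has.trans hy.1.le
    · intro x hx
      rw [interior_Icc] at hx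
      exact h x (has.trans hx.1.le) (hgt x hx)
  exact absurd ((hanti ⟨le_rfl, hst⟩ ⟨hst, le_rfl⟩ hst).trans hsc) (not_le.2 hlt)

/-- The linear differential inequality `f' ≤ -c f` implies exponential decay. -/
theorem le_mul_exp_of_hasDerivAt_le {f f' : ℝ → ℝ} {a c : ℝ}
    (hf : ∀ t ≥ a, HasDerivAt f (f' t) t) (h : ∀ t ≥ a, f' t ≤ -c * f t) {t : ℝ} (ht : a ≤ t) :
    f t ≤ f a * Real.exp (-c * (t - a)) := by
  have hd (s : ℝ) (hs : s ≥ a) : HasDerivAt (fun s ↦ f s * Real.exp (c * (s - a)))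
      (f' s * Real.exp (c * (s - a)) + f s * (Real.exp (c * (s - a)) * c)) s := by
    refine (hf s hs).mul (HasDerivAt.exp ?_)
    simpa using ((hasDerivAt_id s).sub_const a).const_mul c
  have hanti : AntitoneOn (fun s ↦ f s * Real.exp (c * (s - a))) (Ici a) := by
    refine antitoneOn_of_hasDerivWithinAt_nonpos (convex_Ici a)
      (fun s hs ↦ (hd s hs).continuousAt.continuousWithinAt)
      (fun s hs ↦ (hd s (interior_subset hs)).hasDerivWithinAt) fun s hs ↦ ?_
    have := h s (interior_subset hs)
    nlinarith [Real.exp_pos (c * (s - a))]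
  have := hanti self_mem_Ici ht ht
  simp only [sub_self, mul_zero, Real.exp_zero, mul_one] at this
  rw [neg_mul, Real.exp_neg, ← div_eq_mul_inv, le_div_iff₀ (Real.exp_pos _)]
  exact this

/-! ### The radial equation in the polar angle, truncated to be globally Lipschitz. -/

/-- The derivative of `u = m² + n²` along the flow, in polar coordinates. -/
def growth (u φ : ℝ) : ℝ := 2 * u - u ^ 2 * (3 + cos (4 * φ)) / 6

/-- The angular velocity of the flow as a function of `u = m² + n²` and the polar angle. -/
def speed (α u φ : ℝ) : ℝ := α + u * sin (4 * φ) / 12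

/-- A coordinate, strictly increasing in `u`, in which the flow contracts. -/
def potential (α u φ : ℝ) : ℝ := α * u + u ^ 2 * sin (4 * φ) / 24

/-- Truncation of a real number to `[3, 6]`. -/
def clip (u : ℝ) : ℝ := max (min u 6) 3

theorem clip_mem (u : ℝ) : clip u ∈ Icc (3 : ℝ) 6 :=
  ⟨le_max_right _ _, max_le (min_le_right _ _) (by norm_num)⟩

theorem clip_of_mem {u : ℝ} (hu : u ∈ Icc (3 : ℝ) 6) : clip u = u := by
  rw [clip, min_eq_left hu.2, max_eq_left hu.1]

theorem clip_of_le {u : ℝ} (hu : u ≤ 3) : clip u = 3 := by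
  rw [clip, min_eq_left (by linarith), max_eq_right hu]

theorem clip_of_ge {u : ℝ} (hu : 6 ≤ u) : clip u = 6 := by
  rw [clip, min_eq_right hu, max_eq_left (by norm_num)]

theorem abs_clip_sub_le (u v : ℝ) : |clip u - clip v| ≤ |u - v| := by
  simpa [Real.dist_eq, clip] using ((LipschitzWith.id.min_const 6).max_const 3).dist_le_mul u v

/-- Together with `growth_six_nonpos` this says that the field points weakly inward on both boundary
circles of the annulus. -/
theorem growth_three_nonneg (φ : ℝ) : 0 ≤ growth 3 φ := by
  unfold growth; linarith [Real.cos_le_one (4 * φ)]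

theorem growth_six_nonpos (φ : ℝ) : growth 6 φ ≤ 0 := by
  unfold growth; linarith [Real.neg_one_le_cos (4 * φ)]

theorem abs_speed_sub_le {α u : ℝ} (hu : 0 ≤ u) (φ : ℝ) : |speed α u φ - α| ≤ u / 12 := by
  rw [speed, abs_le]
  constructor <;> nlinarith [Real.sin_le_one (4 * φ), Real.neg_one_le_sin (4 * φ)]

theorem half_le_speed {α u : ℝ} (hα : 1 ≤ α) (hu : u ∈ Icc (3 : ℝ) 6) (φ : ℝ) :
    1 / 2 ≤ speed α u φ := by
  linarith [(abs_le.1 (abs_speed_sub_le (α := α) (by linarith [hu.1] : 0 ≤ u) φ)).1, hu.2]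

theorem abs_growth_le {u : ℝ} (hu : u ∈ Icc (3 : ℝ) 6) (φ : ℝ) : |growth u φ| ≤ 36 := by
  obtain ⟨h1, h2⟩ := hu
  have hc1 := Real.cos_le_one (4 * φ)
  have hc2 := Real.neg_one_le_cos (4 * φ)
  have : 0 ≤ u ^ 2 := sq_nonneg u
  have : u ^ 2 ≤ 36 := by nlinarith
  rw [growth, abs_le]
  constructor <;> nlinarith

theorem abs_growth_div_speed_le {α u : ℝ} (hα : 1 ≤ α) (hu : u ∈ Icc (3 : ℝ) 6) (φ : ℝ) :
    |growth u φ / speed α u φ| ≤ 72 := by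
  have hs := half_le_speed hα hu φ
  rw [abs_div, abs_of_pos (by linarith : 0 < speed α u φ), div_le_iff₀ (by linarith)]
  linarith [abs_growth_le hu φ]

theorem abs_growth_div_speed_sub_le {α u v : ℝ} (hα : 1 ≤ α) (hu : u ∈ Icc (3 : ℝ) 6)
    (hv : v ∈ Icc (3 : ℝ) 6) (φ : ℝ) :
    |growth u φ / speed α u φ - growth v φ / speed α v φ| ≤ 48 * α * |u - v| := by
  have hsu := half_le_speed hα hu φ
  have hsv := half_le_speed hα hv φ
  obtain ⟨hu1, hu2⟩ := hu
  obtain ⟨hv1, hv2⟩ := hv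
  -- The constant 48 is 12 · 4: the numerator is at most 12α|u − v| and the denominator at least
  -- 1/4.
  have hpos : 1 / 4 ≤ speed α u φ * speed α v φ := by nlinarith
  have key : growth u φ * speed α v φ - speed α u φ * growth v φ
      = (u - v) * (α * (2 - (3 + cos (4 * φ)) / 6 * (u + v))
        - (3 + cos (4 * φ)) / 6 * (u * v * (sin (4 * φ) / 12))) := by
    unfold growth speed; ring
  have hc1 := Real.cos_le_one (4 * φ)
  have hc2 := Real.neg_one_le_cos (4 * φ)
  have hs1 := Real.sin_le_one (4 * φ)
  have hs2 := Real.neg_one_le_sin (4 * φ)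
  set a := (3 + cos (4 * φ)) / 6 with ha
  set b := sin (4 * φ) / 12 with hb
  have ha1 : 1 / 3 ≤ a := by rw [ha]; linarith
  have ha2 : a ≤ 2 / 3 := by rw [ha]; linarith
  have h1 : |2 - a * (u + v)| ≤ 8 := by
    rw [abs_le]; constructor <;> nlinarith
  have huv : 0 ≤ u * v ∧ u * v ≤ 36 := by constructor <;> nlinarith
  have h2 : |u * v * b| ≤ 3 := by
    rw [abs_mul, abs_of_nonneg huv.1]
    have : |b| ≤ 1 / 12 := by rw [hb, abs_le]; constructor <;> linarith
    nlinarith [abs_nonneg b]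
  have h3 : |α * (2 - a * (u + v)) - a * (u * v * b)| ≤ 12 * α := by
    refine (abs_sub _ _).trans ?_
    rw [abs_mul, abs_mul, abs_of_nonneg (by linarith : 0 ≤ α), abs_of_nonneg (by linarith : 0 ≤ a)]
    nlinarith [abs_nonneg (u * v * b)]
  rw [div_sub_div _ _ (by linarith) (by linarith), key, abs_div, abs_mul,
    abs_of_pos (by linarith : 0 < speed α u φ * speed α v φ), div_le_iff₀ (by linarith)]
  nlinarith [abs_nonneg (u - v), mul_le_mul_of_nonneg_left h3 (abs_nonneg (u - v)),
    mul_le_mul_of_nonneg_left hpos (by positivity : 0 ≤ 48 * α * |u - v|)]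

theorem lipschitzWith_polar_slope {α : ℝ} (hα : 1 ≤ α) (φ : ℝ) :
    LipschitzWith (48 * α).toNNReal fun u ↦ growth (clip u) φ / speed α (clip u) φ := by
  refine LipschitzWith.of_dist_le_mul fun u v ↦ ?_
  rw [Real.dist_eq, Real.dist_eq, Real.coe_toNNReal _ (by linarith)]
  exact (abs_growth_div_speed_sub_le hα (clip_mem u) (clip_mem v) φ).trans
    (mul_le_mul_of_nonneg_left (abs_clip_sub_le u v) (by linarith))

theorem exists_polar_solution {α : ℝ} (hα : 1 ≤ α) (x : ℝ) : ∃ U : ℝ → ℝ, U 0 = x ∧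
    ∀ φ, HasDerivAt U (growth (clip (U φ)) φ / speed α (clip (U φ)) φ) φ := by
  refine exists_global_solution (f := fun φ u ↦ growth (clip u) φ / speed α (clip u) φ)
    (K := (48 * α).toNNReal) (L := 72) (lipschitzWith_polar_slope hα) (fun u ↦ ?_) (fun φ u ↦ ?_) x
  · refine Continuous.div ?_ ?_ fun φ ↦ ?_
    · unfold growth; fun_prop
    · unfold speed; fun_prop
    · exact (by linarith [half_le_speed hα (clip_mem u) φ] : 0 < speed α (clip u) φ).ne'
  · simpa only [Real.norm_eq_abs, NNReal.coe_ofNat] using abs_growth_div_speed_le hα (clip_mem u) φ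

theorem polar_solution_unique {α : ℝ} (hα : 1 ≤ α) {U V : ℝ → ℝ}
    (hU : ∀ φ, HasDerivAt U (growth (clip (U φ)) φ / speed α (clip (U φ)) φ) φ)
    (hV : ∀ φ, HasDerivAt V (growth (clip (V φ)) φ / speed α (clip (V φ)) φ) φ)
    (h : U 0 = V 0) : U = V := by
  exact ODE_solution_unique_univ (v := fun φ u ↦ growth (clip u) φ / speed α (clip u) φ)
    (K := (48 * α).toNNReal) (s := fun _ ↦ univ) (t₀ := 0)
    (fun φ ↦ (lipschitzWith_polar_slope hα φ).lipschitzOnWith)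
    (fun φ ↦ ⟨hU φ, trivial⟩) (fun φ ↦ ⟨hV φ, trivial⟩) h

/-- Outside [3, 6] the truncated slope is frozen at its boundary value, whose sign pushes the
solution back. -/
theorem polar_solution_mem {α : ℝ} (hα : 1 ≤ α) {U : ℝ → ℝ}
    (hU : ∀ φ, HasDerivAt U (growth (clip (U φ)) φ / speed α (clip (U φ)) φ) φ)
    (h : U 0 ∈ Icc (3 : ℝ) 6) {φ : ℝ} (hφ : 0 ≤ φ) : U φ ∈ Icc (3 : ℝ) 6 := by
  have hpos (φ : ℝ) : 0 < speed α (clip (U φ)) φ := by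
    linarith [half_le_speed hα (clip_mem (U φ)) φ]
  constructor
  · refine neg_le_neg_iff.1 (le_of_hasDerivAt_nonpos_above (f := fun φ ↦ -U φ)
      (fun t _ ↦ (hU t).neg.hasDerivWithinAt) (fun t _ ht ↦ ?_) (neg_le_neg h.1) hφ)
    have := hpos t
    rw [clip_of_le (by linarith)] at this ⊢
    exact neg_nonpos.2 (div_nonneg (growth_three_nonneg t) this.le)
  · refine le_of_hasDerivAt_nonpos_above
      (fun t _ ↦ (hU t).hasDerivWithinAt) (fun t _ ht ↦ ?_) h.2 hφ
    have := hpos t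
    rw [clip_of_ge (by linarith)] at this ⊢
    exact div_nonpos_of_nonpos_of_nonneg (growth_six_nonpos t) this.le

/-! ### Contraction at equal angles and the periodic profile. -/

/-- Differentiating sin(4θ) produces a cos(4θ) term that cancels the one in `growth`. The hypothesis
`h` is du/dθ = growth/speed with denominators cleared, so any time parametrization is allowed. -/
theorem hasDerivAt_potential {α : ℝ} {u θ : ℝ → ℝ} {u' q t : ℝ} (hu : HasDerivAt u u' t)
    (hθ : HasDerivAt θ q t) (h : u' * speed α (u t) (θ t) = growth (u t) (θ t) * q) :
    HasDerivAt (fun t ↦ potential α (u t) (θ t)) (q * (2 * u t - u t ^ 2 / 2)) t := by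
  have h1 := (hu.const_mul α).add
    (((hu.pow 2).mul (hθ.const_mul 4).sin).div_const 24)
  unfold potential
  refine h1.congr_deriv ?_
  unfold speed growth at h
  push_cast
  simp only [Pi.pow_apply]
  linear_combination h

theorem potential_sub (α u v φ : ℝ) : potential α u φ - potential α v φ
    = (u - v) * (α + (u + v) * sin (4 * φ) / 24) := by
  unfold potential; ring

theorem abs_slope_potential_le {u v : ℝ} (hu : u ∈ Icc (5 / 2 : ℝ) 8) (hv : v ∈ Icc (5 / 2 : ℝ) 8)
    (α φ : ℝ) : |α + (u + v) * sin (4 * φ) / 24 - α| ≤ 2 / 3 := by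
  rw [abs_le]
  constructor <;>
  nlinarith [Real.sin_le_one (4 * φ), Real.neg_one_le_sin (4 * φ), hu.1, hu.2, hv.1, hv.2]

/-- Two curves in the region `5/2 ≤ u ≤ 8` that follow the flow up to reparametrization and have
the same polar angle at all times approach each other exponentially fast. -/
theorem potential_sub_sq_le {α a : ℝ} (hα : 1 ≤ α) {u v θ u' v' q : ℝ → ℝ}
    (hu : ∀ t ≥ a, HasDerivAt u (u' t) t) (hv : ∀ t ≥ a, HasDerivAt v (v' t) t)
    (hθ : ∀ t ≥ a, HasDerivAt θ (q t) t)
    (hu' : ∀ t ≥ a, u' t * speed α (u t) (θ t) = growth (u t) (θ t) * q t)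
    (hv' : ∀ t ≥ a, v' t * speed α (v t) (θ t) = growth (v t) (θ t) * q t)
    (hum : ∀ t ≥ a, u t ∈ Icc (5 / 2 : ℝ) 8) (hvm : ∀ t ≥ a, v t ∈ Icc (5 / 2 : ℝ) 8)
    (hq : ∀ t ≥ a, 1 / 3 ≤ q t) {t : ℝ} (ht : a ≤ t) :
    (potential α (u t) (θ t) - potential α (v t) (θ t)) ^ 2
      ≤ (potential α (u a) (θ a) - potential α (v a) (θ a)) ^ 2
        * Real.exp (-(1 / (3 * (α + 1))) * (t - a)) := by
  refine le_mul_exp_of_hasDerivAt_le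
    (f := fun t ↦ (potential α (u t) (θ t) - potential α (v t) (θ t)) ^ 2)
    (fun s hs ↦ ((hasDerivAt_potential (hu s hs) (hθ s hs) (hu' s hs)).sub
      (hasDerivAt_potential (hv s hs) (hθ s hs) (hv' s hs))).pow 2) (fun s hs ↦ ?_) ht
  have hκ := abs_le.1 (abs_slope_potential_le (hum s hs) (hvm s hs) α (θ s))
  have hq := hq s hs
  obtain ⟨hu1, hu2⟩ := hum s hs
  obtain ⟨hv1, hv2⟩ := hvm s hs
  simp only [Pi.sub_apply, potential_sub]
  set κ := α + (u s + v s) * sin (4 * θ s) / 24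
  have hκ0 : 0 < κ := by linarith [hκ.1]
  have hκ1 : κ ≤ α + 1 := by linarith [hκ.2]
  -- The logarithmic decay rate of the square is 2q((u + v)/2 − 2)/κ, at least 2 · (1/3) · (1/2)/(α
  -- + 1).
  have hp : 1 / 2 ≤ (u s + v s) / 2 - 2 := by linarith
  have hqp : 1 / 6 ≤ q s * ((u s + v s) / 2 - 2) := by nlinarith
  have hk2 : κ * (1 / (α + 1)) ≤ 1 := by
    rw [mul_one_div, div_le_one (by linarith)]; exact hκ1
  have e1 : (1 / (3 * (α + 1))) = 1 / 3 * (1 / (α + 1)) := by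
    rw [one_div_mul_one_div]
  rw [e1]
  have hX : 0 ≤ (u s - v s) ^ 2 * κ := by positivity
  have e2 : 1 / 3 * (κ * (1 / (α + 1))) ≤ 2 * (q s * ((u s + v s) / 2 - 2)) := by linarith
  have := mul_le_mul_of_nonneg_left e2 hX
  push_cast
  linarith

/-- There is a `2π`-periodic solution of the equation for `u` as a function of the polar angle. -/
theorem exists_periodic_polar_solution {α : ℝ} (hα : 1 ≤ α) : ∃ U : ℝ → ℝ,
    (∀ φ, U φ ∈ Icc (3 : ℝ) 6) ∧ Function.Periodic U (2 * Real.pi) ∧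
    ∀ φ, HasDerivAt U (growth (U φ) φ / speed α (U φ) φ) φ := by
  choose U hU0 hU using exists_polar_solution hα
  have hmem (x : ℝ) (hx : x ∈ Icc (3 : ℝ) 6) (φ : ℝ) (hφ : 0 ≤ φ) : U x φ ∈ Icc (3 : ℝ) 6 :=
    polar_solution_mem hα (hU x) (by rwa [hU0]) hφ
  have hsub : Icc (3 : ℝ) 6 ⊆ Icc (5 / 2) 8 := Icc_subset_Icc (by norm_num) (by norm_num)
  have hpi : 0 ≤ 2 * Real.pi := by positivity
  have hsol (x : ℝ) (hx : x ∈ Icc (3 : ℝ) 6) (φ : ℝ) (hφ : φ ≥ 0) :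
      HasDerivAt (U x) (growth (U x φ) φ / speed α (U x φ) φ) φ := by
    simpa only [clip_of_mem (hmem x hx φ hφ)] using hU x φ
  have hslope (x : ℝ) (hx : x ∈ Icc (3 : ℝ) 6) (φ : ℝ) (hφ : φ ≥ 0) :
      growth (U x φ) φ / speed α (U x φ) φ * speed α (U x φ) φ = growth (U x φ) φ * 1 := by
    rw [mul_one, div_mul_cancel₀]
    exact (by linarith [half_le_speed hα (hmem x hx φ hφ) φ] : 0 < speed α (U x φ) φ).ne'
  have hlip (x : ℝ) (hx : x ∈ Icc (3 : ℝ) 6) (y : ℝ) (hy : y ∈ Icc (3 : ℝ) 6) :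
      |U x (2 * Real.pi) - U y (2 * Real.pi)| ≤ |x - y| := by
    have h := potential_sub_sq_le hα (a := 0) (u := U x) (v := U y) (θ := fun φ ↦ φ)
      (q := fun _ ↦ 1) (hsol x hx) (hsol y hy) (fun t _ ↦ hasDerivAt_id t) (hslope x hx)
      (hslope y hy) (fun t ht ↦ hsub (hmem x hx t ht)) (fun t ht ↦ hsub (hmem y hy t ht))
      (fun _ _ ↦ by norm_num) hpi
    -- At angles 0 and 2π the potential is just αu, so contraction of potentials is contraction of
    -- u.
    have hs : sin (4 * (2 * Real.pi)) = 0 := by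
      rw [show 4 * (2 * Real.pi) = (8 : ℕ) * Real.pi by push_cast; ring, Real.sin_nat_mul_pi]
    simp only [potential_sub, hs, mul_zero, Real.sin_zero, zero_div, add_zero, hU0] at h
    have hexp : Real.exp (-(1 / (3 * (α + 1))) * (2 * Real.pi - 0)) ≤ 1 := by
      rw [Real.exp_le_one_iff]
      have : 0 ≤ 1 / (3 * (α + 1)) := by positivity
      nlinarith
    have h2 := h.trans (mul_le_of_le_one_right (sq_nonneg _) hexp)
    rw [sq_le_sq, abs_mul, abs_mul] at h2
    exact le_of_mul_le_mul_right h2 (abs_pos.2 (by linarith))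
  obtain ⟨x, hx, hfix⟩ := exists_mem_Icc_isFixedPt_of_mapsTo
    (f := fun x ↦ U x (2 * Real.pi)) (a := 3) (b := 6)
    (LipschitzOnWith.continuousOn (K := 1) (LipschitzOnWith.of_dist_le_mul fun x hx y hy ↦ by
      simpa [Real.dist_eq] using hlip x hx y hy)) (by norm_num)
    (fun x hx ↦ hmem x hx _ hpi)
  have hper : Function.Periodic (U x) (2 * Real.pi) := by
    refine congrFun (polar_solution_unique hα (U := fun φ ↦ U x (φ + 2 * Real.pi))
      (fun φ ↦ ?_) (hU x) ?_)
    · have := (hU x (φ + 2 * Real.pi)).comp_add_const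
      have e : 4 * (φ + 2 * Real.pi) = 4 * φ + (4 : ℕ) * (2 * Real.pi) := by push_cast; ring
      simpa only [growth, speed, e, Real.cos_add_nat_mul_two_pi, Real.sin_add_nat_mul_two_pi]
        using this
    · rw [zero_add, hU0]; exact hfix
  -- Invariance only covers φ ≥ 0; periodicity carries it to negative angles.
  have hall (φ : ℝ) : U x φ ∈ Icc (3 : ℝ) 6 := by
    obtain ⟨ψ, hψ, h⟩ := hper.exists_mem_Ico₀ Real.two_pi_pos φ
    rw [h]
    exact hmem x hx ψ hψ.1
  exact ⟨U x, hall, hper, fun φ ↦ by simpa only [clip_of_mem (hall φ)] using hU x φ⟩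

/-! ### Coordinates of the plane and the polar form of the field. -/

theorem hasDerivWithinAt_plane {γ : ℝ → Plane} {v : Plane} {s : Set ℝ} {t : ℝ} :
    HasDerivWithinAt γ v s t ↔
      HasDerivWithinAt (γ · 0) (v 0) s t ∧ HasDerivWithinAt (γ · 1) (v 1) s t := by
  rw [hasDerivWithinAt_iff_hasFDerivWithinAt, hasFDerivWithinAt_euclidean, Fin.forall_fin_two]
  simp only [hasDerivWithinAt_iff_hasFDerivWithinAt]
  refine and_congr (iff_of_eq ?_) (iff_of_eq ?_) <;> congr 1

theorem hasDerivAt_plane {γ : ℝ → Plane} {v : Plane} {t : ℝ} :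
    HasDerivAt γ v t ↔ HasDerivAt (γ · 0) (v 0) t ∧ HasDerivAt (γ · 1) (v 1) t := by
  simp only [← hasDerivWithinAt_univ, hasDerivWithinAt_plane]

theorem norm_sq_plane (z : Plane) : ‖z‖ ^ 2 = z 0 ^ 2 + z 1 ^ 2 := by
  simp [EuclideanSpace.norm_sq_eq]

theorem contDiff_field (α : ℝ) : ContDiff ℝ 1 (field α) := by
  have h0 : ContDiff ℝ 1 fun z : Plane ↦ z 0 := contDiff_euclidean.1 contDiff_id 0
  have h1 : ContDiff ℝ 1 fun z : Plane ↦ z 1 := contDiff_euclidean.1 contDiff_id 1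
  rw [contDiff_euclidean, Fin.forall_fin_two]
  simp only [field]
  constructor
  · exact ((contDiff_const.mul h1).add h0).sub ((h0.pow 3).div_const 3)
  · exact ((contDiff_const.mul h0).add h1).sub ((h1.pow 3).div_const 3)

/-- The point with squared distance `u` from the origin and polar angle `φ`. -/
def polarPoint (u φ : ℝ) : Plane := !₂[√u * cos φ, √u * sin φ]

theorem norm_polarPoint (u φ : ℝ) : ‖polarPoint u φ‖ = √u := by
  refine (pow_left_inj₀ (norm_nonneg _) (Real.sqrt_nonneg _) two_ne_zero).1 ?_
  rw [norm_sq_plane]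
  simp only [polarPoint, PiLp.toLp_apply, Matrix.cons_val_zero, Matrix.cons_val_one]
  linear_combination √u ^ 2 * Real.sin_sq_add_cos_sq φ

theorem polarPoint_eq_smul (u φ : ℝ) : polarPoint u φ = √u • !₂[cos φ, sin φ] := by
  ext i; fin_cases i <;> simp [polarPoint]

theorem continuous_polarPoint : Continuous fun p : ℝ × ℝ ↦ polarPoint p.1 p.2 := by
  simp only [polarPoint_eq_smul]
  fun_prop

theorem dist_polarPoint (u v φ : ℝ) : dist (polarPoint u φ) (polarPoint v φ) = |√u - √v| := by
  have : ‖!₂[cos φ, sin φ]‖ = 1 := by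
    have := norm_polarPoint 1 φ
    rwa [polarPoint_eq_smul, Real.sqrt_one, one_smul] at this
  rw [dist_eq_norm, polarPoint_eq_smul, polarPoint_eq_smul, ← sub_smul, norm_smul, this, mul_one,
    Real.norm_eq_abs]

theorem exists_int_of_polarPoint_eq {u v φ ψ : ℝ} (hu : 0 < u)
    (h : polarPoint u φ = polarPoint v ψ) : ∃ k : ℤ, φ - ψ = 2 * Real.pi * k := by
  have hr : √u = √v := by rw [← norm_polarPoint u φ, h, norm_polarPoint]
  have hpos := Real.sqrt_pos.2 hu
  have h0 := congrArg (fun z : Plane ↦ z 0) h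
  have h1 := congrArg (fun z : Plane ↦ z 1) h
  simp only [polarPoint, PiLp.toLp_apply, Matrix.cons_val_zero, Matrix.cons_val_one, ← hr,
    mul_right_inj' hpos.ne'] at h0 h1
  exact Real.Angle.angle_eq_iff_two_pi_dvd_sub.1 (Real.Angle.cos_sin_inj h0 h1)

theorem periodic_speed (α u : ℝ) : Function.Periodic (speed α u) (2 * Real.pi) := fun φ ↦ by
  rw [speed, show 4 * (φ + 2 * Real.pi) = 4 * φ + (4 : ℕ) * (2 * Real.pi) by push_cast; ring,
    Real.sin_add_nat_mul_two_pi, speed]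

theorem periodic_polarPoint (u : ℝ) : Function.Periodic (polarPoint u) (2 * Real.pi) := fun φ ↦ by
  simp [polarPoint]

theorem cos_four_mul (φ : ℝ) : cos (4 * φ) = 2 * (2 * cos φ ^ 2 - 1) ^ 2 - 1 := by
  rw [show 4 * φ = 2 * (2 * φ) by ring, Real.cos_two_mul, Real.cos_two_mul]

theorem sin_four_mul (φ : ℝ) : sin (4 * φ) = 4 * sin φ * cos φ * (2 * cos φ ^ 2 - 1) := by
  rw [show 4 * φ = 2 * (2 * φ) by ring, Real.sin_two_mul, Real.sin_two_mul, Real.cos_two_mul]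
  ring

/-- In polar coordinates the flow is given by `growth` and `speed`. -/
theorem hasDerivAt_polarPoint {α : ℝ} {u θ : ℝ → ℝ} {t : ℝ} (hpos : 0 < u t)
    (hu : HasDerivAt u (growth (u t) (θ t)) t) (hθ : HasDerivAt θ (speed α (u t) (θ t)) t) :
    HasDerivAt (fun t ↦ polarPoint (u t) (θ t)) (field α (polarPoint (u t) (θ t))) t := by
  have hr := hu.sqrt hpos.ne'
  have hr2 : u t = √(u t) ^ 2 := (Real.sq_sqrt hpos.le).symm
  have hsc := Real.sin_sq (θ t)
  rw [hasDerivAt_plane]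
  simp only [polarPoint, field, PiLp.toLp_apply, Matrix.cons_val_zero, Matrix.cons_val_one]
  have e : growth (u t) (θ t) / (2 * √(u t))
      = √(u t) - √(u t) ^ 3 * (3 + cos (4 * θ t)) / 12 := by
    rw [div_eq_iff (by positivity), growth]
    conv_lhs => rw [hr2]
    ring
  have e' : speed α (u t) (θ t) = α + √(u t) ^ 2 * sin (4 * θ t) / 12 := by
    rw [speed, ← hr2]
  constructor
  · refine (hr.mul hθ.cos).congr_deriv ?_
    rw [e, e', sin_four_mul, cos_four_mul]
    linear_combination
      (-(√(u t) ^ 3) / 3 * cos (θ t) * (2 * cos (θ t) ^ 2 - 1)) * hsc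
  · refine (hr.mul hθ.sin).congr_deriv ?_
    rw [e, e', sin_four_mul, cos_four_mul]
    linear_combination
      (√(u t) ^ 3 / 3 * sin (θ t)) * hsc

/-! ### The closed orbit, its period and its winding number. -/

/-- `U` is a `2π`-periodic solution, with values in `[3, 6]`, of the equation satisfied by `m² + n²`
as a function of the polar angle. -/
structure IsPeriodicProfile (α : ℝ) (U : ℝ → ℝ) : Prop where
  mem : ∀ φ, U φ ∈ Icc (3 : ℝ) 6
  periodic : Function.Periodic U (2 * Real.pi)
  hasDerivAt : ∀ φ, HasDerivAt U (growth (U φ) φ / speed α (U φ) φ) φ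

/-- The closed curve with the given radial profile. -/
def profileCurve (U : ℝ → ℝ) (φ : ℝ) : Plane := polarPoint (U φ) φ

/-- `θ` is the polar angle at time `t` of a motion along the curve with profile `U`, with
period `T`. -/
structure IsPeriodicAngle (α : ℝ) (U θ : ℝ → ℝ) (T : ℝ) : Prop where
  map_zero : θ 0 = 0
  hasDerivAt : ∀ t, HasDerivAt θ (speed α (U (θ t)) (θ t)) t
  pos : 0 < T
  map_period : θ T = 2 * Real.pi
  map_add_period : ∀ t, θ (t + T) = θ t + 2 * Real.pi

namespace IsPeriodicProfile

variable {α : ℝ} {U : ℝ → ℝ}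

theorem continuous (hU : IsPeriodicProfile α U) : Continuous U :=
  continuous_iff_continuousAt.2 fun φ ↦ (hU.hasDerivAt φ).continuousAt

theorem pos (hU : IsPeriodicProfile α U) (φ : ℝ) : 0 < U φ := by linarith [(hU.mem φ).1]

theorem speed_mem (hU : IsPeriodicProfile α U) (φ : ℝ) :
    speed α (U φ) φ ∈ Icc (α - 1 / 2) (α + 1 / 2) := by
  have h := abs_le.1 (abs_speed_sub_le (α := α) (hU.pos φ).le φ)
  have h6 := (hU.mem φ).2
  constructor <;> linarith [h.1, h.2]

theorem continuous_profileCurve (hU : IsPeriodicProfile α U) : Continuous (profileCurve U) :=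
  continuous_polarPoint.comp (hU.continuous.prodMk continuous_id)

theorem periodic_profileCurve (hU : IsPeriodicProfile α U) :
    Function.Periodic (profileCurve U) (2 * Real.pi) := fun φ ↦ by
  rw [profileCurve, hU.periodic, periodic_polarPoint, profileCurve]

theorem isCompact_range (hU : IsPeriodicProfile α U) : IsCompact (range (profileCurve U)) :=
  hU.periodic_profileCurve.compact_of_continuous Real.two_pi_pos.ne' hU.continuous_profileCurve

theorem range_subset_annulus (hU : IsPeriodicProfile α U) :
    range (profileCurve U) ⊆ annulus := by
  rintro _ ⟨φ, rfl⟩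
  have h : profileCurve U φ 0 ^ 2 + profileCurve U φ 1 ^ 2 = U φ := by
    rw [← norm_sq_plane, profileCurve, norm_polarPoint, Real.sq_sqrt (hU.pos φ).le]
  have hm := hU.mem φ
  rw [← h] at hm
  exact hm

theorem lipschitzWith_speed (hα : 1 ≤ α) (hU : IsPeriodicProfile α U) :
    LipschitzWith 8 fun φ ↦ speed α (U φ) φ := by
  have hd (φ : ℝ) : HasDerivAt (fun φ ↦ speed α (U φ) φ)
      ((growth (U φ) φ / speed α (U φ) φ * sin (4 * φ) + U φ * (cos (4 * φ) * (4 * 1))) / 12) φ :=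
    (((hU.hasDerivAt φ).mul ((hasDerivAt_id φ).const_mul 4).sin).div_const 12).const_add α
  refine lipschitzWith_of_nnnorm_deriv_le (fun φ ↦ (hd φ).differentiableAt) fun φ ↦ ?_
  rw [(hd φ).deriv, ← NNReal.coe_le_coe, coe_nnnorm, Real.norm_eq_abs, abs_div]
  have h1 := abs_growth_div_speed_le hα (hU.mem φ) φ
  have h2 := Real.abs_sin_le_one (4 * φ)
  have h3 := Real.abs_cos_le_one (4 * φ)
  have h6 := (hU.mem φ).2
  have h5 := hU.pos φ
  have h7 : |growth (U φ) φ / speed α (U φ) φ * sin (4 * φ)| ≤ 72 := by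
    rw [abs_mul]; nlinarith [abs_nonneg (sin (4 * φ))]
  have h8 : |U φ * (cos (4 * φ) * (4 * 1))| ≤ 24 := by
    rw [abs_mul, abs_mul, abs_of_pos h5, abs_of_pos (by norm_num : (0 : ℝ) < 4 * 1)]
    nlinarith [abs_nonneg (cos (4 * φ))]
  have h9 := abs_add_le (growth (U φ) φ / speed α (U φ) φ * sin (4 * φ))
    (U φ * (cos (4 * φ) * (4 * 1)))
  rw [abs_of_pos (by norm_num : (0 : ℝ) < 12), div_le_iff₀ (by norm_num)]
  rw [NNReal.coe_ofNat]
  exact h9.trans ((add_le_add h7 h8).trans (by norm_num))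

/-- The angular equation is autonomous with 2π-periodic right-hand side: θ(t + T) and θ(t) + 2π both
solve it and agree at t = 0. -/
theorem exists_isPeriodicAngle (hα : 1 ≤ α) (hU : IsPeriodicProfile α U) :
    ∃ θ T, IsPeriodicAngle α U θ T := by
  have hlip := hU.lipschitzWith_speed hα
  obtain ⟨θ, h0, hθ⟩ := exists_global_solution (f := fun _ φ ↦ speed α (U φ) φ)
    (L := (α + 1 / 2).toNNReal) (fun _ ↦ hlip) (fun _ ↦ continuous_const) (fun _ φ ↦ by
      have := hU.speed_mem φ
      rw [Real.norm_eq_abs, Real.coe_toNNReal _ (by linarith), abs_of_nonneg] <;>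
      linarith [this.1, this.2]) 0
  have hmono : MonotoneOn (fun t ↦ θ t - t / 2) univ := by
    have hd (t : ℝ) := (hθ t).sub ((hasDerivAt_id t).div_const 2)
    refine (monotone_of_hasDerivAt_nonneg (fun t ↦ hd t) fun t ↦ ?_).monotoneOn univ
    have := (hU.speed_mem (θ t)).1
    simp only [Pi.zero_apply]
    linarith
  have hcont : Continuous θ := continuous_iff_continuousAt.2 fun t ↦ (hθ t).continuousAt
  -- Since θ' ≥ 1/2, a full turn takes at most time 4π.
  have hbig : 2 * Real.pi ≤ θ (4 * Real.pi) := by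
    have := hmono (mem_univ 0) (mem_univ (4 * Real.pi)) (by positivity)
    simp only [h0] at this
    linarith
  obtain ⟨T, hT, hθT⟩ := intermediate_value_Icc (by positivity : 0 ≤ 4 * Real.pi)
    hcont.continuousOn (show 2 * Real.pi ∈ Icc (θ 0) (θ (4 * Real.pi)) from
      ⟨by rw [h0]; positivity, hbig⟩)
  refine ⟨θ, T, h0, hθ, lt_of_le_of_ne hT.1 ?_, hθT, congrFun (ODE_solution_unique_univ
    (v := fun _ φ ↦ speed α (U φ) φ) (s := fun _ ↦ univ) (t₀ := 0) (fun _ ↦ hlip.lipschitzOnWith)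
    (fun t ↦ ⟨(hθ (t + T)).comp_add_const, trivial⟩) (fun t ↦ ⟨?_, trivial⟩) ?_)⟩
  · rintro rfl
    rw [h0] at hθT
    exact Real.two_pi_pos.ne hθT
  · rw [hU.periodic, periodic_speed]
    exact (hθ t).add_const _
  · rw [zero_add, hθT, h0, zero_add]

end IsPeriodicProfile

namespace IsPeriodicAngle

variable {α : ℝ} {U θ : ℝ → ℝ} {T : ℝ}

theorem continuous (hθ : IsPeriodicAngle α U θ T) : Continuous θ :=
  continuous_iff_continuousAt.2 fun t ↦ (hθ.hasDerivAt t).continuousAt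

theorem strictMono (hα : 1 ≤ α) (hU : IsPeriodicProfile α U) (hθ : IsPeriodicAngle α U θ T) :
    StrictMono θ :=
  strictMono_of_hasDerivAt_pos hθ.hasDerivAt fun t ↦ by linarith [(hU.speed_mem (θ t)).1]

theorem map_add_int_mul_period (hθ : IsPeriodicAngle α U θ T) (k : ℤ) (t : ℝ) :
    θ (t + k * T) = θ t + k * (2 * Real.pi) := by
  induction k using Int.induction_on with
  | zero => simp
  | succ n ih =>
    rw [show t + ((n + 1 : ℤ) : ℝ) * T = t + (n : ℤ) * T + T by push_cast; ring,
      hθ.map_add_period, ih]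
    push_cast; ring
  | pred n ih =>
    have := hθ.map_add_period (t + ((-n - 1 : ℤ) : ℝ) * T)
    rw [show t + ((-n - 1 : ℤ) : ℝ) * T + T = t + ((-n : ℤ) : ℝ) * T by push_cast; ring, ih] at this
    push_cast at this ⊢
    linarith

theorem surjective (hθ : IsPeriodicAngle α U θ T) : Function.Surjective θ := by
  intro φ
  obtain ⟨k, hk⟩ : ∃ k : ℤ, φ - k * (2 * Real.pi) ∈ Icc 0 (2 * Real.pi) := by
    refine ⟨⌊φ / (2 * Real.pi)⌋, ?_⟩
    have h1 := (le_div_iff₀ Real.two_pi_pos).1 (Int.floor_le (φ / (2 * Real.pi)))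
    have h2 := (div_lt_iff₀ Real.two_pi_pos).1 (Int.lt_floor_add_one (φ / (2 * Real.pi)))
    constructor <;> linarith
  obtain ⟨t, -, ht⟩ := intermediate_value_Icc hθ.pos.le hθ.continuous.continuousOn
    (by rwa [hθ.map_zero, hθ.map_period] : φ - k * (2 * Real.pi) ∈ Icc (θ 0) (θ T))
  exact ⟨t + k * T, by rw [hθ.map_add_int_mul_period, ht]; ring⟩

/-- By the mean value theorem 2π/T is a value of the angular velocity, hence within 1/2 of α. -/
theorem period_mem (hα : 1 ≤ α) (hU : IsPeriodicProfile α U) (hθ : IsPeriodicAngle α U θ T) :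
    T ∈ Icc (4 * Real.pi / (2 * α + 1)) (4 * Real.pi / (2 * α - 1)) := by
  obtain ⟨c, -, hc⟩ := exists_hasDerivAt_eq_slope θ (fun t ↦ speed α (U (θ t)) (θ t)) hθ.pos
    hθ.continuous.continuousOn fun t _ ↦ hθ.hasDerivAt t
  rw [hθ.map_period, hθ.map_zero, sub_zero, sub_zero, eq_div_iff hθ.pos.ne'] at hc
  have h := hU.speed_mem (θ c)
  have hT := hθ.pos
  constructor
  · rw [div_le_iff₀ (by linarith)]
    nlinarith [mul_le_mul_of_nonneg_right h.2 hT.le]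
  · rw [le_div_iff₀ (by linarith)]
    nlinarith [mul_le_mul_of_nonneg_right h.1 hT.le]

theorem isSolution (hα : 1 ≤ α) (hU : IsPeriodicProfile α U) (hθ : IsPeriodicAngle α U θ T) :
    IsSolution (field α) fun t ↦ profileCurve U (θ t) := by
  intro t
  refine hasDerivAt_polarPoint (u := fun t ↦ U (θ t)) (hU.pos _) ?_ (hθ.hasDerivAt t)
  refine ((hU.hasDerivAt (θ t)).comp t (hθ.hasDerivAt t)).congr_deriv (div_mul_cancel₀ _ ?_)
  exact (by linarith [(hU.speed_mem (θ t)).1] : 0 < speed α (U (θ t)) (θ t)).ne'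

theorem periodic_profileCurve (hU : IsPeriodicProfile α U) (hθ : IsPeriodicAngle α U θ T) :
    Function.Periodic (fun t ↦ profileCurve U (θ t)) T := fun t ↦ by
  simp only [hθ.map_add_period, hU.periodic_profileCurve (θ t)]

theorem range_profileCurve (hθ : IsPeriodicAngle α U θ T) :
    range (fun t ↦ profileCurve U (θ t)) = range (profileCurve U) :=
  hθ.surjective.range_comp (profileCurve U)

/-- A return to the same point changes the strictly increasing angle by a positive multiple of 2π,
so by at least one turn. -/
theorem period_le (hα : 1 ≤ α) (hU : IsPeriodicProfile α U) (hθ : IsPeriodicAngle α U θ T)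
    {S : ℝ} (hS : 0 < S) (h : profileCurve U (θ S) = profileCurve U (θ 0)) : T ≤ S := by
  obtain ⟨k, hk⟩ := exists_int_of_polarPoint_eq (hU.pos _) h
  have hmono := hθ.strictMono hα hU
  have h1 : 0 < 2 * Real.pi * k := by rw [← hk]; linarith [hmono hS]
  have h2 : (1 : ℝ) ≤ k := by
    have : (0 : ℝ) < k := pos_of_mul_pos_right h1 Real.two_pi_pos.le
    exact_mod_cast this
  rw [← hmono.le_iff_le, hθ.map_period]
  rw [hθ.map_zero, sub_zero] at hk
  rw [hk]
  nlinarith [Real.pi_pos]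

theorem solution_on_orbit (hα : 1 ≤ α) (hU : IsPeriodicProfile α U)
    (hθ : IsPeriodicAngle α U θ T) {γ : ℝ → Plane} (hγ : IsSolution (field α) γ)
    (h0 : γ 0 ∈ range (profileCurve U)) :
    range γ = range (profileCurve U) ∧ IsMinimalPeriod γ T ∧ HasWindingNumber γ T 1 := by
  obtain ⟨φ, hφ⟩ := h0
  obtain ⟨s, rfl⟩ := hθ.surjective φ
  obtain rfl : γ = fun t ↦ profileCurve U (θ (t + s)) :=
    eq_of_contDiff (contDiff_field α) (t₀ := 0) hγ
      (fun t ↦ (hθ.isSolution hα hU (t + s)).comp_add_const) (by simp [hφ])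
  refine ⟨?_, ⟨⟨hθ.pos, fun t ↦ ?_⟩, fun S hS ↦ ?_⟩, fun t ↦ θ (t + s), ?_, fun t _ ↦ ?_, ?_⟩
  · rw [← hθ.range_profileCurve]
    exact (Equiv.addRight s).surjective.range_comp (fun t ↦ profileCurve U (θ t))
  · simpa only [add_right_comm] using hθ.periodic_profileCurve hU (t + s)
  · refine hθ.period_le hα hU hS.1 ?_
    have := hS.2 (-s)
    simpa using this
  · exact (hθ.continuous.comp (continuous_add_const s)).continuousOn
  · simp only [profileCurve, norm_polarPoint]
    refine ⟨fun h ↦ ?_, polarPoint_eq_smul _ _⟩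
    have := norm_polarPoint (U (θ (t + s))) (θ (t + s))
    rw [h, norm_zero] at this
    exact (Real.sqrt_pos.2 (hU.pos _)).ne this
  · simp only [zero_add, add_comm T s, hθ.map_add_period]
    push_cast; ring

end IsPeriodicAngle

/-! ### Attraction of trajectories to the closed orbit. -/

theorem field_zero (α : ℝ) : field α 0 = 0 := by
  ext i; fin_cases i <;> simp [field]

theorem continuous_plane_apply (i : Fin 2) : Continuous fun z : Plane ↦ z i := by fun_prop

/-- Gives 2u − 2u²/3 ≤ u' ≤ 2u − u²/3, with positive zeros 3 and 6. -/
theorem quartic_bounds (m n : ℝ) :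
    (m ^ 2 + n ^ 2) ^ 2 / 2 ≤ m ^ 4 + n ^ 4 ∧ m ^ 4 + n ^ 4 ≤ (m ^ 2 + n ^ 2) ^ 2 :=
  ⟨by nlinarith [sq_nonneg (m ^ 2 - n ^ 2)], by nlinarith [sq_nonneg (m * n)]⟩

/-- The square of the norm, as a polynomial in the coordinates. -/
def normSq (z : Plane) : ℝ := z 0 ^ 2 + z 1 ^ 2

theorem normSq_pos {z : Plane} (hz : z ≠ 0) : 0 < normSq z := by
  rw [normSq, ← norm_sq_plane]
  positivity

theorem hasDerivAt_normSq {γ : ℝ → Plane} {v : Plane} {t : ℝ} (h : HasDerivAt γ v t) :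
    HasDerivAt (fun t ↦ normSq (γ t)) (2 * (γ t 0 * v 0 + γ t 1 * v 1)) t := by
  obtain ⟨h0, h1⟩ := hasDerivAt_plane.1 h
  refine ((h0.pow 2).add (h1.pow 2)).congr_deriv ?_
  push_cast
  ring

theorem inner_field (α : ℝ) (z : Plane) : z 0 * field α z 0 + z 1 * field α z 1
    = normSq z - (z 0 ^ 4 + z 1 ^ 4) / 3 := by
  simp only [field, normSq, PiLp.toLp_apply, Matrix.cons_val_zero, Matrix.cons_val_one]
  ring

theorem exists_polarPoint_eq (z : Plane) : ∃ φ, z = polarPoint (normSq z) φ := by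
  refine ⟨Complex.arg ⟨z 0, z 1⟩, ?_⟩
  have hn : √(normSq z) = ‖(⟨z 0, z 1⟩ : ℂ)‖ := by
    rw [Complex.norm_def, Complex.normSq_mk, normSq, sq, sq]
  ext i
  fin_cases i
  · simp [polarPoint, hn]
  · simp [polarPoint, hn]

theorem IsForwardTrajectory.hasDerivAt {F : Plane → Plane} {γ : ℝ → Plane}
    (hγ : IsForwardTrajectory F γ) {t : ℝ} (ht : 0 < t) : HasDerivAt γ (F (γ t)) t :=
  (hγ t ht.le).hasDerivAt (Ici_mem_nhds ht)

/-- Uniqueness applied both forwards and backwards from the interior time t > 0. -/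
theorem IsForwardTrajectory.ne_zero {α : ℝ} {γ : ℝ → Plane}
    (hγ : IsForwardTrajectory (field α) γ) (h : ¬ ∀ t : ℝ, 0 ≤ t → γ t = 0) {t : ℝ} (ht : 0 < t) :
    γ t ≠ 0 := by
  intro h0
  refine h fun s hs ↦ ?_
  refine eqOn_Icc_of_contDiff (contDiff_field α) (a := 0) (b := max s t + 1) (t₀ := t) (g := 0)
    ⟨ht, by linarith [le_max_right s t]⟩ (hγ.continuousOn.mono Icc_subset_Ici_self)
    (fun r hr ↦ hγ.hasDerivAt hr.1) continuousOn_const (fun r _ ↦ ?_) h0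
    ⟨hs, by linarith [le_max_left s t]⟩
  rw [Pi.zero_apply, field_zero]
  exact hasDerivAt_const r 0

theorem tendsto_exp_decay (C a : ℝ) {c : ℝ} (hc : 0 < c) :
    Tendsto (fun t ↦ C * Real.exp (-c * (t - a))) atTop (𝓝 0) := by
  have h : Tendsto (fun t ↦ -c * (t - a)) atTop atBot :=
    (tendsto_atTop_add_const_right _ (-a) tendsto_id).const_mul_atTop_of_neg (neg_neg_of_pos hc)
  simpa using (Real.tendsto_exp_atBot.comp h).const_mul C

/-- Every trajectory other than the equilibrium eventually enters a neighbourhood of the annulus. -/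
theorem IsForwardTrajectory.eventually_normSq_mem {α : ℝ} {γ : ℝ → Plane}
    (hγ : IsForwardTrajectory (field α) γ) (h : ¬ ∀ t : ℝ, 0 ≤ t → γ t = 0) :
    ∀ᶠ t in atTop, normSq (γ t) ∈ Icc (5 / 2 : ℝ) 8 := by
  have hpos (t : ℝ) (ht : t ≥ 1) : 0 < normSq (γ t) := normSq_pos (hγ.ne_zero h (by linarith))
  have hw (t : ℝ) (ht : t ≥ 1) := (hasDerivAt_normSq (hγ.hasDerivAt (t := t) (by linarith))).inv
    (hpos t ht).ne'
  have hup : ∀ t ≥ 1, (normSq (γ t))⁻¹ - 1 / 3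
      ≤ ((normSq (γ 1))⁻¹ - 1 / 3) * Real.exp (-2 * (t - 1)) := by
    refine fun t ht ↦ le_mul_exp_of_hasDerivAt_le (f := fun t ↦ (normSq (γ t))⁻¹ - 1 / 3)
      (fun s hs ↦ (hw s hs).sub_const (1 / 3)) (fun s hs ↦ ?_) ht
    have hp := hpos s hs
    have hq := (quartic_bounds (γ s 0) (γ s 1)).2
    rw [inner_field, div_le_iff₀ (by positivity)]
    have e : -2 * ((normSq (γ s))⁻¹ - 1 / 3) * normSq (γ s) ^ 2
        = -2 * normSq (γ s) + 2 / 3 * normSq (γ s) ^ 2 := by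
      field_simp
      ring
    rw [e]
    change _ ≤ normSq (γ s) ^ 2 at hq
    linarith
  have hlo : ∀ t ≥ 1, 1 / 6 - (normSq (γ t))⁻¹
      ≤ (1 / 6 - (normSq (γ 1))⁻¹) * Real.exp (-2 * (t - 1)) := by
    refine fun t ht ↦ le_mul_exp_of_hasDerivAt_le (f := fun t ↦ 1 / 6 - (normSq (γ t))⁻¹)
      (fun s hs ↦ (hw s hs).const_sub (1 / 6)) (fun s hs ↦ ?_) ht
    have hp := hpos s hs
    have hq := (quartic_bounds (γ s 0) (γ s 1)).1
    rw [inner_field, neg_div, neg_neg, div_le_iff₀ (by positivity)]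
    have e : -2 * (1 / 6 - (normSq (γ s))⁻¹) * normSq (γ s) ^ 2
        = 2 * normSq (γ s) - 1 / 3 * normSq (γ s) ^ 2 := by
      field_simp
      ring
    rw [e]
    change normSq (γ s) ^ 2 / 2 ≤ _ at hq
    linarith
  -- The margins are 1/15 = 2/5 − 1/3 and 1/24 = 1/6 − 1/8.
  have t1 := (tendsto_exp_decay ((normSq (γ 1))⁻¹ - 1 / 3) 1 two_pos).eventually_lt_const
    (by norm_num : (0 : ℝ) < 1 / 15)
  have t2 := (tendsto_exp_decay (1 / 6 - (normSq (γ 1))⁻¹) 1 two_pos).eventually_lt_const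
    (by norm_num : (0 : ℝ) < 1 / 24)
  filter_upwards [t1, t2, eventually_ge_atTop 1] with t ht1 ht2 ht
  have h1 := hup t ht
  have h2 := hlo t ht
  have hp := hpos t ht
  have h3 : (normSq (γ t))⁻¹ ≤ (5 / 2)⁻¹ := by linarith
  have h4 : 8⁻¹ ≤ (normSq (γ t))⁻¹ := by linarith
  exact ⟨(inv_le_inv₀ hp (by norm_num)).1 h3, (inv_le_inv₀ (by norm_num) hp).1 h4⟩

/-- A nonvanishing trajectory has a differentiable polar angle. -/
theorem exists_polar_angle {α a : ℝ} {γ : ℝ → Plane}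
    (hγ : ∀ t ≥ a, HasDerivAt γ (field α (γ t)) t) (h0 : ∀ t ≥ a, γ t ≠ 0) :
    ∃ θ : ℝ → ℝ, (∀ t ≥ a, γ t = polarPoint (normSq (γ t)) (θ t)) ∧
      ∀ t ≥ a, HasDerivAt θ (speed α (normSq (γ t)) (θ t)) t := by
  have hpos (t : ℝ) (ht : t ≥ a) : 0 < normSq (γ t) := normSq_pos (h0 t ht)
  obtain ⟨φ, hφ⟩ := exists_polarPoint_eq (γ a)
  -- The angular velocity in Cartesian form; the angle is defined as its integral, with `max s a`
  -- making the integrand continuous on the whole line.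
  set ω : ℝ → ℝ := fun t ↦
    α + γ t 0 * γ t 1 * (γ t 0 ^ 2 - γ t 1 ^ 2) / (3 * normSq (γ t)) with hω
  have hγc : Continuous fun t ↦ γ (max t a) := continuous_iff_continuousAt.2 fun t ↦
    (hγ _ (le_max_right t a)).continuousAt.comp (f := fun t ↦ max t a) (by fun_prop)
  have hωc : Continuous fun t ↦ ω (max t a) := by
    have c0 := (continuous_plane_apply 0).comp hγc
    have c1 := (continuous_plane_apply 1).comp hγc
    refine continuous_const.add (Continuous.div ?_ ?_ fun t ↦ ?_)
    · exact (c0.mul c1).mul ((c0.pow 2).sub (c1.pow 2))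
    · exact continuous_const.mul ((c0.pow 2).add (c1.pow 2))
    · exact mul_ne_zero three_ne_zero (hpos _ (le_max_right t a)).ne'
  set θ : ℝ → ℝ := fun t ↦ φ + ∫ s in a..t, ω (max s a) with hθ
  have hθd (t : ℝ) (ht : t ≥ a) : HasDerivAt θ (ω t) t := by
    have := (intervalIntegral.integral_hasDerivAt_right (hωc.intervalIntegrable a t)
      (hωc.stronglyMeasurableAtFilter _ _) hωc.continuousAt).const_add φ
    rwa [max_eq_left ht] at this
  set A : ℝ → ℝ := fun t ↦ 1 - (γ t 0 ^ 4 + γ t 1 ^ 4) / (3 * normSq (γ t)) with hA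
  have hm (t : ℝ) (ht : t ≥ a) : HasDerivAt (γ · 0) (A t * γ t 0 - ω t * γ t 1) t := by
    refine (hasDerivAt_plane.1 (hγ t ht)).1.congr_deriv ?_
    have hp := (hpos t ht).ne'
    simp only [hA, hω, field, PiLp.toLp_apply, Matrix.cons_val_zero]
    field_simp
    simp only [normSq]
    ring
  have hn (t : ℝ) (ht : t ≥ a) : HasDerivAt (γ · 1) (A t * γ t 1 + ω t * γ t 0) t := by
    refine (hasDerivAt_plane.1 (hγ t ht)).2.congr_deriv ?_
    have hp := (hpos t ht).ne'
    simp only [hA, hω, field, PiLp.toLp_apply, Matrix.cons_val_one, Matrix.cons_val_zero]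
    field_simp
    simp only [normSq]
    ring
  have hr (t : ℝ) (ht : t ≥ a) :
      HasDerivAt (fun t ↦ √(normSq (γ t))) (A t * √(normSq (γ t))) t := by
    refine ((hasDerivAt_normSq (hγ t ht)).sqrt (hpos t ht).ne').congr_deriv ?_
    have hp := hpos t ht
    have hs := Real.sqrt_pos.2 hp
    have e : A t * normSq (γ t) = normSq (γ t) - (γ t 0 ^ 4 + γ t 1 ^ 4) / 3 := by
      simp only [hA]
      field_simp
    rw [inner_field, ← e, div_eq_iff (by positivity)]
    linear_combination (-2 * A t) * Real.sq_sqrt hp.le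
  -- In the frame rotating with θ both coordinates of γ satisfy the same equation f' = Af as the
  -- radius, so their ratios to it are constant.
  have hconst (f : ℝ → ℝ) (hf : ∀ t ≥ a, HasDerivAt f (A t * f t) t) (t : ℝ) (ht : t ≥ a) :
      f t / √(normSq (γ t)) = f a / √(normSq (γ a)) := by
    have hd (s : ℝ) (hs : s ≥ a) : HasDerivAt (fun t ↦ f t / √(normSq (γ t))) 0 s := by
      refine ((hf s hs).div (hr s hs) (Real.sqrt_pos.2 (hpos s hs)).ne').congr_deriv ?_
      rw [div_eq_zero_iff]
      left; ring
    exact constant_of_has_deriv_right_zero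
      (fun s hs ↦ (hd s hs.1).continuousAt.continuousWithinAt)
      (fun s hs ↦ (hd s hs.1).hasDerivWithinAt) t ⟨ht, le_rfl⟩
  have hθa : θ a = φ := by simp [hθ]
  have hra := Real.sqrt_pos.2 (hpos a le_rfl)
  have ha0 : γ a 0 = √(normSq (γ a)) * cos φ := congrArg (fun z : Plane ↦ z 0) hφ
  have ha1 : γ a 1 = √(normSq (γ a)) * sin φ := congrArg (fun z : Plane ↦ z 1) hφ
  have hpol (t : ℝ) (ht : t ≥ a) : γ t = polarPoint (normSq (γ t)) (θ t) := by
    have hrt := Real.sqrt_pos.2 (hpos t ht)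
    have h1 := hconst (fun t ↦ γ t 0 * cos (θ t) + γ t 1 * sin (θ t)) (fun s hs ↦
      (((hm s hs).mul (hθd s hs).cos).add ((hn s hs).mul (hθd s hs).sin)).congr_deriv
        (by ring)) t ht
    have h2 := hconst (fun t ↦ γ t 1 * cos (θ t) - γ t 0 * sin (θ t)) (fun s hs ↦
      (((hn s hs).mul (hθd s hs).cos).sub ((hm s hs).mul (hθd s hs).sin)).congr_deriv
        (by ring)) t ht
    have e1 : γ a 0 * cos φ + γ a 1 * sin φ = √(normSq (γ a)) := by
      linear_combination cos φ * ha0 + sin φ * ha1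
        + √(normSq (γ a)) * Real.sin_sq_add_cos_sq φ
    have e2 : γ a 1 * cos φ - γ a 0 * sin φ = 0 := by
      linear_combination cos φ * ha1 - sin φ * ha0
    simp only [hθa, e1, e2, div_self hra.ne', zero_div, div_eq_iff hrt.ne', one_mul,
      zero_mul] at h1 h2
    have hsc := Real.sin_sq_add_cos_sq (θ t)
    ext i
    fin_cases i
    · change γ t 0 = √(normSq (γ t)) * cos (θ t)
      linear_combination cos (θ t) * h1 - sin (θ t) * h2 - γ t 0 * hsc
    · change γ t 1 = √(normSq (γ t)) * sin (θ t)
      linear_combination sin (θ t) * h1 + cos (θ t) * h2 - γ t 1 * hsc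
  refine ⟨θ, hpol, fun t ht ↦ (hθd t ht).congr_deriv ?_⟩
  have h0 : γ t 0 = √(normSq (γ t)) * cos (θ t) := congrArg (fun z : Plane ↦ z 0) (hpol t ht)
  have h1 : γ t 1 = √(normSq (γ t)) * sin (θ t) := congrArg (fun z : Plane ↦ z 1) (hpol t ht)
  have hp := hpos t ht
  have hs4 : γ t 0 * γ t 1 * (γ t 0 ^ 2 - γ t 1 ^ 2)
      = normSq (γ t) ^ 2 * sin (4 * θ t) / 4 := by
    rw [h0, h1, sin_four_mul]
    have hsc := Real.sin_sq (θ t)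
    have hq := Real.sq_sqrt hp.le
    generalize √(normSq (γ t)) = r at hq
    rw [← hq]
    linear_combination (-r ^ 4 * sin (θ t) * cos (θ t)) * hsc
  simp only [hω, hs4, speed]
  field_simp
  ring

theorem growth_eq_of_polarPoint {z : Plane} {φ : ℝ} (h : z = polarPoint (normSq z) φ) :
    growth (normSq z) φ = 2 * (normSq z - (z 0 ^ 4 + z 1 ^ 4) / 3) := by
  have h0 : z 0 = √(normSq z) * cos φ := congrArg (fun z : Plane ↦ z 0) h
  have h1 : z 1 = √(normSq z) * sin φ := congrArg (fun z : Plane ↦ z 1) h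
  have hq : √(normSq z) ^ 2 = normSq z := Real.sq_sqrt (by unfold normSq; positivity)
  have e : z 0 ^ 4 + z 1 ^ 4 = normSq z ^ 2 * (3 + cos (4 * φ)) / 4 := by
    rw [h0, h1, cos_four_mul, mul_pow, mul_pow]
    have hsc := Real.sin_sq φ
    generalize √(normSq z) = r at hq
    rw [← hq]
    linear_combination r ^ 4 * (sin φ ^ 2 + 1 - cos φ ^ 2) * hsc
  rw [e, growth]
  ring

/-- Every trajectory other than the equilibrium approaches the closed curve with a periodic profile,
with a polar angle that tends to infinity. -/
theorem IsForwardTrajectory.exists_asymptotic_angle {α : ℝ} (hα : 1 ≤ α) {U : ℝ → ℝ}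
    (hU : IsPeriodicProfile α U) {γ : ℝ → Plane}
    (hγ : IsForwardTrajectory (field α) γ) (h : ¬ ∀ t : ℝ, 0 ≤ t → γ t = 0) :
    ∃ (θ : ℝ → ℝ) (a : ℝ), ContinuousOn θ (Ici a) ∧ Tendsto θ atTop atTop ∧
      Tendsto (fun t ↦ dist (γ t) (profileCurve U (θ t))) atTop (𝓝 0) := by
  obtain ⟨a, ha⟩ := eventually_atTop.1
    ((hγ.eventually_normSq_mem h).and (eventually_gt_atTop 0))
  obtain ⟨θ, hpol, hθ⟩ := exists_polar_angle (fun t ht ↦ hγ.hasDerivAt (ha t ht).2)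
    fun t ht ↦ hγ.ne_zero h (ha t ht).2
  have hq (t : ℝ) (ht : t ≥ a) : 1 / 3 ≤ speed α (normSq (γ t)) (θ t) := by
    obtain ⟨h1, h2⟩ := (ha t ht).1
    linarith [(abs_le.1 (abs_speed_sub_le (α := α) (by linarith : 0 ≤ normSq (γ t)) (θ t))).1]
  have hθc : ContinuousOn θ (Ici a) := fun t ht ↦ (hθ t ht).continuousAt.continuousWithinAt
  refine ⟨θ, a, hθc, ?_, ?_⟩
  · have hmono : MonotoneOn (fun t ↦ θ t - t / 3) (Ici a) := by
      have hd (t : ℝ) (ht : t ≥ a) := (hθ t ht).sub ((hasDerivAt_id t).div_const 3)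
      refine monotoneOn_of_hasDerivWithinAt_nonneg (convex_Ici a)
        (fun t ht ↦ (hd t ht).continuousAt.continuousWithinAt)
        (fun t ht ↦ (hd t (interior_subset ht)).hasDerivWithinAt) fun t ht ↦ ?_
      linarith [hq t (interior_subset ht)]
    refine tendsto_atTop_mono' _ (f₁ := fun t ↦ t / 3 + (θ a - a / 3)) ?_
      (tendsto_atTop_add_const_right _ _ (tendsto_id.atTop_div_const (by norm_num)))
    filter_upwards [eventually_ge_atTop a] with t ht
    have := hmono self_mem_Ici ht ht
    simp only at this
    linarith
  have hsub : Icc (3 : ℝ) 6 ⊆ Icc (5 / 2) 8 := Icc_subset_Icc (by norm_num) (by norm_num)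
  have hD (t : ℝ) (ht : t ≥ a) := potential_sub_sq_le hα (a := a) (u := fun t ↦ normSq (γ t))
    (v := fun t ↦ U (θ t)) (θ := θ) (t := t)
    (fun s hs ↦ hasDerivAt_normSq (hγ.hasDerivAt (ha s hs).2))
    (fun s hs ↦ (hU.hasDerivAt (θ s)).comp s (hθ s hs)) hθ
    (fun s hs ↦ by rw [inner_field, growth_eq_of_polarPoint (hpol s hs)])
    (fun s hs ↦ by
      have : 0 < speed α (U (θ s)) (θ s) := by linarith [(hU.speed_mem (θ s)).1]
      field_simp)
    (fun s hs ↦ (ha s hs).1) (fun s hs ↦ hsub (hU.mem _)) hq ht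
  set c := 1 / (3 * (α + 1)) with hc
  have hc0 : 0 < c := by positivity
  set B := (potential α (normSq (γ a)) (θ a) - potential α (U (θ a)) (θ a)) ^ 2
  have hlim : Tendsto (fun t ↦ √(9 * (B * Real.exp (-c * (t - a))))) atTop (𝓝 0) := by
    simpa using ((tendsto_exp_decay B a hc0).const_mul 9).sqrt
  refine squeeze_zero' (Eventually.of_forall fun t ↦ dist_nonneg) ?_ hlim
  filter_upwards [eventually_ge_atTop a] with t ht
  have hu := (ha t ht).1
  have hv := hU.mem (θ t)
  have hκ := (abs_le.1 (abs_slope_potential_le hu (hsub hv) α (θ t))).1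
  have hDt := hD t ht
  rw [potential_sub] at hDt
  have e : dist (γ t) (profileCurve U (θ t)) = |√(normSq (γ t)) - √(U (θ t))| := by
    rw [← dist_polarPoint (normSq (γ t)) (U (θ t)) (θ t), ← hpol t ht, profileCurve]
  rw [e]
  refine Real.abs_le_sqrt (le_trans ?_ (mul_le_mul_of_nonneg_left hDt (by norm_num)))
  set κ := α + (normSq (γ t) + U (θ t)) * sin (4 * θ t) / 24
  -- Here κ ≥ α − 2/3 ≥ 1/3, the origin of the factor 9 in the bound.
  have hκ3 : 1 ≤ 9 * κ ^ 2 := by nlinarith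
  set r := √(normSq (γ t)) with hr
  set s := √(U (θ t)) with hs
  have hr2 : r ^ 2 = normSq (γ t) := Real.sq_sqrt (by linarith [hu.1])
  have hs2 : s ^ 2 = U (θ t) := Real.sq_sqrt (by linarith [hv.1])
  have hr1 : 1 ≤ r := Real.one_le_sqrt.2 (by linarith [hu.1])
  have hs1 : 1 ≤ s := Real.one_le_sqrt.2 (by linarith [hv.1])
  rw [← hr2, ← hs2]
  have h1 : 1 ≤ (r + s) ^ 2 := by nlinarith
  calc (r - s) ^ 2 ≤ (r - s) ^ 2 * (r + s) ^ 2 := le_mul_of_one_le_right (sq_nonneg _) h1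
    _ = (r ^ 2 - s ^ 2) ^ 2 := by ring
    _ ≤ (r ^ 2 - s ^ 2) ^ 2 * (9 * κ ^ 2) := le_mul_of_one_le_right (sq_nonneg _) hκ3
    _ = 9 * ((r ^ 2 - s ^ 2) * κ) ^ 2 := by ring

/-! ### ω-limit sets and forward existence. -/

theorem tendsto_infDist_of_asymptotic {C : Set Plane} {γ δ : ℝ → Plane} (hδ : ∀ t, δ t ∈ C)
    (h : Tendsto (fun t ↦ dist (γ t) (δ t)) atTop (𝓝 0)) :
    Tendsto (fun t ↦ Metric.infDist (γ t) C) atTop (𝓝 0) :=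
  squeeze_zero (fun _ ↦ Metric.infDist_nonneg) (fun t ↦ Metric.infDist_le_dist_of_mem (hδ t)) h

theorem omegaLimitSet_subset {C : Set Plane} (hC : IsClosed C) (hne : C.Nonempty) {γ : ℝ → Plane}
    (h : Tendsto (fun t ↦ Metric.infDist (γ t) C) atTop (𝓝 0)) : omegaLimitSet γ ⊆ C := by
  intro p hp
  rw [hC.mem_iff_infDist_zero hne]
  have hcl : MapClusterPt (Metric.infDist p C) atTop fun t ↦ Metric.infDist (γ t) C :=
    MapClusterPt.continuousAt_comp (f := fun z ↦ Metric.infDist z C)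
      (Metric.continuous_infDist_pt C).continuousAt hp
  have : (𝓝 (Metric.infDist p C) ⊓ 𝓝 0).NeBot := ClusterPt.mono hcl h
  exact eq_of_nhds_neBot this

/-- By the intermediate value theorem θ takes values φ + 2πk at arbitrarily late times, when γ is
close to δ(φ). -/
theorem range_subset_omegaLimitSet {δ : ℝ → Plane} (hδ : Function.Periodic δ (2 * Real.pi))
    {γ : ℝ → Plane} {θ : ℝ → ℝ} {a : ℝ} (hc : ContinuousOn θ (Ici a))
    (hθ : Tendsto θ atTop atTop) (h : Tendsto (fun t ↦ dist (γ t) (δ (θ t))) atTop (𝓝 0)) :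
    range δ ⊆ omegaLimitSet γ := by
  rintro _ ⟨φ, rfl⟩
  refine mapClusterPt_iff_frequently.2 fun s hs ↦ ?_
  obtain ⟨ε, hε, hball⟩ := Metric.mem_nhds_iff.1 hs
  refine frequently_atTop.2 fun N ↦ ?_
  obtain ⟨M, hM⟩ := eventually_atTop.1 ((h.eventually_lt_const hε).and
    ((eventually_ge_atTop a).and (eventually_ge_atTop N)))
  obtain ⟨k, hk⟩ := exists_nat_ge ((θ M - φ) / (2 * Real.pi))
  rw [div_le_iff₀ Real.two_pi_pos] at hk
  obtain ⟨M', hM'θ, hM'⟩ := ((hθ.eventually_ge_atTop (φ + k * (2 * Real.pi))).and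
    (eventually_ge_atTop M)).exists
  obtain ⟨t, ht, htθ⟩ := intermediate_value_Icc hM'
    (hc.mono fun x hx ↦ (hM M le_rfl).2.1.trans hx.1)
    (⟨by linarith, hM'θ⟩ : φ + k * (2 * Real.pi) ∈ Icc (θ M) (θ M'))
  have hMt := hM t ht.1
  refine ⟨t, hMt.2.2, hball ?_⟩
  have := hMt.1
  rwa [htθ, hδ.nat_mul k φ] at this

theorem omegaLimitSet_of_periodic {γ : ℝ → Plane} (hc : Continuous γ) {T : ℝ} (hT : 0 < T)
    (h : Function.Periodic γ T) : omegaLimitSet γ = range γ := by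
  have hcl : IsClosed (range γ) := (h.compact_of_continuous hT.ne' hc).isClosed
  apply Subset.antisymm
  · refine omegaLimitSet_subset hcl (range_nonempty γ) ?_
    simpa only [Metric.infDist_zero_of_mem (mem_range_self _)] using tendsto_const_nhds
  · rintro _ ⟨s, rfl⟩
    refine mapClusterPt_iff_frequently.2 fun V hV ↦ frequently_atTop.2 fun N ↦ ?_
    obtain ⟨k, hk⟩ := exists_nat_ge ((N - s) / T)
    rw [div_le_iff₀ hT] at hk
    exact ⟨s + k * T, by linarith, by rw [h.nat_mul k s]; exact mem_of_mem_nhds hV⟩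

/-- Trajectories exist for all positive times. -/
theorem exists_forwardTrajectory (α : ℝ) (z : Plane) :
    ∃ γ : ℝ → Plane, γ 0 = z ∧ IsForwardTrajectory (field α) γ := by
  -- Adding 3 gives R² ≥ 9 > 6, so the norm cannot grow beyond R and the solution of the cut-off
  -- equation stays where the cutoff is 1.
  set R := ‖z‖ + 3 with hR
  have hRpos : 0 < R := by positivity
  let χ : ContDiffBump (0 : Plane) := ⟨R, R + 1, hRpos, by linarith⟩
  have hsupp : HasCompactSupport fun z ↦ χ z • field α z := χ.hasCompactSupport.smul_right
  have hsmooth : ContDiff ℝ 1 fun z ↦ χ z • field α z := χ.contDiff.smul (contDiff_field α)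
  obtain ⟨K, hK⟩ := hsmooth.lipschitzWith_of_hasCompactSupport hsupp one_ne_zero
  obtain ⟨L, hL⟩ := hsupp.exists_bound_of_continuous hsmooth.continuous
  obtain ⟨γ, h0, hγ⟩ := exists_global_solution (f := fun _ z ↦ χ z • field α z)
    (L := L.toNNReal) (fun _ ↦ hK) (fun _ ↦ continuous_const)
    (fun _ z ↦ (hL z).trans (Real.le_coe_toNNReal L)) z
  have hbound (t : ℝ) (ht : 0 ≤ t) : normSq (γ t) ≤ R ^ 2 := by
    refine le_of_hasDerivAt_nonpos_above (f := fun t ↦ normSq (γ t))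
      (fun s _ ↦ (hasDerivAt_normSq (hγ s)).hasDerivWithinAt) (fun s _ hs ↦ ?_) ?_ ht
    · have e : γ s 0 * (χ (γ s) • field α (γ s)) 0 + γ s 1 * (χ (γ s) • field α (γ s)) 1
          = χ (γ s) * (normSq (γ s) - (γ s 0 ^ 4 + γ s 1 ^ 4) / 3) := by
        rw [← inner_field α]
        simp only [PiLp.smul_apply, smul_eq_mul]
        ring
      rw [e]
      have hq := (quartic_bounds (γ s 0) (γ s 1)).1
      change normSq (γ s) ^ 2 / 2 ≤ _ at hq
      have h9 : 6 ≤ normSq (γ s) := by nlinarith [norm_nonneg z]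
      have : normSq (γ s) - (γ s 0 ^ 4 + γ s 1 ^ 4) / 3 ≤ 0 := by nlinarith
      nlinarith [χ.nonneg (x := γ s)]
    · rw [h0, normSq, ← norm_sq_plane]
      gcongr
      linarith
  refine ⟨γ, h0, fun t ht ↦ ?_⟩
  have h1 : χ (γ t) = 1 := by
    refine χ.one_of_mem_closedBall (mem_closedBall_zero_iff.2 ?_)
    have := hbound t ht
    rw [normSq, ← norm_sq_plane] at this
    exact le_of_sq_le_sq this hRpos.le
  have := hγ t
  rw [h1, one_smul] at this
  exact this.hasDerivWithinAt

end LimitCycle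

end

/-! ### The limit cycle theorem. -/

theorem proposition2p1 (α : ℝ) (hα : 1 ≤ α) :
    ∃ (C : Set LimitCycle.Plane) (T : ℝ),
      -- `C` is the unique non-constant periodic orbit
      LimitCycle.IsNonconstantPeriodicOrbit (LimitCycle.field α) C ∧
      (∀ C' : Set LimitCycle.Plane,
        LimitCycle.IsNonconstantPeriodicOrbit (LimitCycle.field α) C' → C' = C) ∧
      -- it lies in the annulus
      C ⊆ LimitCycle.annulus ∧
      -- `T` is the minimal period of the motion along `C`, during which it winds once
      -- (anticlockwise) around the origin
      (∀ γ : ℝ → LimitCycle.Plane, LimitCycle.IsSolution (LimitCycle.field α) γ → γ 0 ∈ C →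
        range γ = C ∧ LimitCycle.IsMinimalPeriod γ T ∧ LimitCycle.HasWindingNumber γ T 1) ∧
      -- trajectories exist for all positive times from every starting point, and `C` is the
      -- limit cycle of each of them except the one that stays put at the origin
      (∀ z : LimitCycle.Plane, ∃ γ : ℝ → LimitCycle.Plane,
        γ 0 = z ∧ LimitCycle.IsForwardTrajectory (LimitCycle.field α) γ) ∧
      (∀ γ : ℝ → LimitCycle.Plane, LimitCycle.IsForwardTrajectory (LimitCycle.field α) γ →
        (¬ ∀ t : ℝ, 0 ≤ t → γ t = 0) →
        LimitCycle.omegaLimitSet γ = C ∧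
        Tendsto (fun t ↦ Metric.infDist (γ t) C) atTop (𝓝 0)) ∧
      -- the bounds on the minimal period
      4 * Real.pi / (2 * α + 1) ≤ T ∧ T ≤ 4 * Real.pi / (2 * α - 1) := by
  obtain ⟨U, hmem, hper, hder⟩ := LimitCycle.exists_periodic_polar_solution hα
  have hU : LimitCycle.IsPeriodicProfile α U := ⟨hmem, hper, hder⟩
  obtain ⟨θ, T, hθ⟩ := hU.exists_isPeriodicAngle hα
  have hlimit (γ : ℝ → LimitCycle.Plane)
      (hγ : LimitCycle.IsForwardTrajectory (LimitCycle.field α) γ)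
      (h0 : ¬ ∀ t : ℝ, 0 ≤ t → γ t = 0) :
      LimitCycle.omegaLimitSet γ = range (LimitCycle.profileCurve U) ∧
      Tendsto (fun t ↦ Metric.infDist (γ t) (range (LimitCycle.profileCurve U))) atTop (𝓝 0) := by
    obtain ⟨ψ, a, hψc, hψ, hdist⟩ := hγ.exists_asymptotic_angle hα hU h0
    have hinf := LimitCycle.tendsto_infDist_of_asymptotic
      (fun t ↦ mem_range_self (f := LimitCycle.profileCurve U) (ψ t)) hdist
    exact ⟨Subset.antisymm
      (LimitCycle.omegaLimitSet_subset hU.isCompact_range.isClosed (range_nonempty _) hinf)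
      (LimitCycle.range_subset_omegaLimitSet hU.periodic_profileCurve hψc hψ hdist), hinf⟩
  refine ⟨range (LimitCycle.profileCurve U), T, ?_, ?_, hU.range_subset_annulus,
    fun γ ↦ hθ.solution_on_orbit hα hU, LimitCycle.exists_forwardTrajectory α, hlimit,
    (hθ.period_mem hα hU).1, (hθ.period_mem hα hU).2⟩
  · refine ⟨_, hθ.isSolution hα hU, ⟨T, hθ.pos, hθ.periodic_profileCurve hU⟩, ⟨T / 2, 0, ?_⟩,
      hθ.range_profileCurve⟩
    intro h
    linarith [hθ.period_le hα hU (half_pos hθ.pos) h, hθ.pos]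
  · rintro C' ⟨γ, hγ, ⟨S, hS, hγS⟩, ⟨s, t, hst⟩, rfl⟩
    have hcont : Continuous γ := continuous_iff_continuousAt.2 fun t ↦ (hγ t).continuousAt
    rw [← LimitCycle.omegaLimitSet_of_periodic hcont hS hγS]
    refine (hlimit γ (hγ.isIntegralCurveOn _) fun h ↦ hst ?_).1
    -- Vanishing for t ≥ 0 spreads to all times by periodicity, contradicting non-constancy.
    have hzero (r : ℝ) : γ r = 0 := by
      obtain ⟨r', hr', e⟩ := hγS.exists_mem_Ico₀ hS r
      rw [e]
      exact h r' hr'.1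
    rw [hzero, hzero]
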